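/- Let $V$ be a finite-dimensional real vector space, let $N\subseteq V$ be a $\mathbb{Z}$-structure on $V$ (a finitely generated subgroup of rank $\dim V$ with $\langle N\rangle_{\mathbb{R}}=V$), and let $M=\{u\in V^*\mid u(N)\subseteq\mathbb{Z}\}$ be its dual. An $N$-polycone is the set of linear combinations with coefficients in $\mathbb{R}_{\geq 0}$ of a finite subset of $N$; it is sharp if it contains no line. A face of an $N$-polycone $\sigma$ is a set of the form $\sigma\cap\ker(u)$ with $u\in\sigma^\vee\cap M$, where $\sigma^\vee=\{u\in V^*\mid u(\sigma)\subseteq\mathbb{R}_{\geq 0}\}$. Let $\Sigma$ be an $N$-fan in $V$, that is, a finite (possibly empty) set of sharp $N$-polycones that is closed under taking faces and such that the intersection of two cones in $\Sigma$ is a common face of both of them. It is called complete if $\bigcup_{\sigma\in\Sigma}\sigma=V$. Let $R$ be a commutative ring, and let $X_\Sigma(R)\to\operatorname{Spec}(R)$ be the toric scheme over $R$ associated with $\Sigma$, that is, the inductive limit over $\Sigma$ (ordered by the relation "$\tau$ is a face of $\sigma$") of the $R$-schemes $X_\sigma(R)=\operatorname{Spec}(R[\sigma^\vee\cap M])$,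 obtained by glueing these along the open subschemes $X_{\sigma\cap\tau}(R)$. Then the structure morphism $X_\Sigma(R)\to\operatorname{Spec}(R)$ is proper if and only if $\Sigma$ is complete, or $\Sigma=\emptyset$, or $R=0$. -/

import Mathlib

open CategoryTheory CategoryTheory.Limits AlgebraicGeometry

universe u

noncomputable section

namespace Toric

section Cones

variable {V : Type u} [AddCommGroup V] [Module ℝ V]

/-- `N` is a `ℤ`-structure on the real vector space `V`: a (finitely generated, hence free)
subgroup of rank `dim V` that spans `V` over `ℝ`. -/
structure IsZStructure (N : AddSubgroup V) : Prop where
  fg : N.FG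
  rank_eq : Module.finrank ℤ N = Module.finrank ℝ V
  span_eq_top : Submodule.span ℝ (N : Set V) = ⊤

/-- The dual `M = N^*` of `N`, as a subgroup of the dual space `V^*`: the linear forms that take
integral values on `N`. -/
def dualLattice (N : AddSubgroup V) : AddSubgroup (Module.Dual ℝ V) where
  carrier := {u | ∀ x ∈ N, ∃ k : ℤ, u x = k}
  zero_mem' _ _ := ⟨0, by simp⟩
  add_mem' := by
    intro a b ha hb x hx
    obtain ⟨k, hk⟩ := ha x hx
    obtain ⟨l, hl⟩ := hb x hx
    exact ⟨k + l, by simp [hk, hl]⟩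
  neg_mem' := by
    intro a ha x hx
    obtain ⟨k, hk⟩ := ha x hx
    exact ⟨-k, by simp [hk]⟩

/-- The dual cone `σ^∨ = {u ∈ V^* | u(σ) ⊆ ℝ_{≥ 0}}`. -/
def dualCone (σ : PointedCone ℝ V) : PointedCone ℝ (Module.Dual ℝ V) :=
  PointedCone.dual (Module.Dual.eval ℝ V) (σ : Set V)

theorem mem_dualCone {σ : PointedCone ℝ V} {u : Module.Dual ℝ V} :
    u ∈ dualCone σ ↔ ∀ x ∈ σ, 0 ≤ u x := Iff.rfl

/-- The monoid `σ^∨ ∩ M`. -/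
def dualMonoid (N : AddSubgroup V) (σ : PointedCone ℝ V) : AddSubmonoid (Module.Dual ℝ V) :=
  (dualCone σ).toAddSubmonoid ⊓ (dualLattice N).toAddSubmonoid

theorem mem_dualMonoid {N : AddSubgroup V} {σ : PointedCone ℝ V} {u : Module.Dual ℝ V} :
    u ∈ dualMonoid N σ ↔ (∀ x ∈ σ, 0 ≤ u x) ∧ u ∈ dualLattice N := Iff.rfl

theorem dualMonoid_anti (N : AddSubgroup V) {τ σ : PointedCone ℝ V} (h : τ ≤ σ) :
    dualMonoid N σ ≤ dualMonoid N τ :=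
  fun _ hu => ⟨fun _ hx => hu.1 (h hx), hu.2⟩

/-- An `N`-polycone: the set of linear combinations with coefficients in `ℝ_{≥ 0}` of a finite
subset of `N`. -/
def IsPolycone (N : AddSubgroup V) (σ : PointedCone ℝ V) : Prop :=
  ∃ s : Finset V, (s : Set V) ⊆ N ∧ σ = PointedCone.hull ℝ (s : Set V)

/-- A cone is sharp if it contains no line, i.e. the largest linear subspace contained in it
is zero. -/
def IsSharp (σ : PointedCone ℝ V) : Prop := σ.lineal = ⊥

/-- `τ` is a face of `σ`: it is of the form `σ ∩ ker u` with `u ∈ σ^∨ ∩ M`. -/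
def IsFace (N : AddSubgroup V) (τ σ : PointedCone ℝ V) : Prop :=
  ∃ u ∈ dualMonoid N σ, (τ : Set V) = (σ : Set V) ∩ {x | u x = 0}

end Cones

/-- An `N`-fan in `V`: a finite set of sharp `N`-polycones that is closed under taking faces and
in which the intersection of two cones is a common face of both of them. -/
structure Fan {V : Type u} [AddCommGroup V] [Module ℝ V] (N : AddSubgroup V) where
  cones : Set (PointedCone ℝ V)
  finite : cones.Finite
  isPolycone : ∀ σ ∈ cones, IsPolycone N σ
  isSharp : ∀ σ ∈ cones, IsSharp σ
  face_mem : ∀ σ ∈ cones, ∀ τ, IsFace N τ σ → τ ∈ cones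
  isFace_inter : ∀ σ ∈ cones, ∀ τ ∈ cones, IsFace N (σ ⊓ τ) σ ∧ IsFace N (σ ⊓ τ) τ


section Localization

variable {V : Type u} [AddCommGroup V] [Module ℝ V] {N : AddSubgroup V}

theorem IsFace.le {τ σ : PointedCone ℝ V} (h : IsFace N τ σ) : τ ≤ σ := by
  obtain ⟨w, _, e⟩ := h
  intro x hx
  have : x ∈ (τ : Set V) := hx
  rw [e] at this
  exact this.1

/-- If `τ = σ ∩ ker w`, every element of `τ^∨ ∩ M` is moved into `σ^∨ ∩ M` by a multiple of `w`. -/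
theorem exists_add_nsmul_mem {τ σ : PointedCone ℝ V} (hσ : IsPolycone N σ)
    {w : Module.Dual ℝ V} (hw : w ∈ dualMonoid N σ)
    (e : (τ : Set V) = (σ : Set V) ∩ {x | w x = 0}) {m : Module.Dual ℝ V}
    (hm : m ∈ dualMonoid N τ) :
    ∃ k : ℕ, ∀ l : ℕ, k ≤ l → m + l • w ∈ dualMonoid N σ := by
  obtain ⟨s, hs, rfl⟩ := hσ
  have key : ∀ x ∈ s, ∃ k : ℕ, ∀ l : ℕ, k ≤ l → 0 ≤ m x + l * w x := by
    intro x hx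
    have hxσ : x ∈ PointedCone.hull ℝ (s : Set V) := Submodule.subset_span hx
    have h0 : 0 ≤ w x := hw.1 hxσ
    rcases h0.eq_or_lt with h | h
    · have hxτ : x ∈ (τ : Set V) := by
        rw [e]
        exact ⟨hxσ, h.symm⟩
      have : 0 ≤ m x := hm.1 hxτ
      exact ⟨0, fun l _ => by rw [← h]; simpa using this⟩
    · obtain ⟨k, hk⟩ := exists_nat_ge (-(m x) / w x)
      refine ⟨k, fun l hl => ?_⟩
      have h1 : -(m x) / w x ≤ l := hk.trans (by exact_mod_cast hl)
      rw [div_le_iff₀ h] at h1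
      linarith
  choose! k hk using key
  refine ⟨s.sup k, fun l hl => mem_dualMonoid.2 ⟨fun x hx => ?_, ?_⟩⟩
  · refine Submodule.span_induction (p := fun x _ => 0 ≤ (m + l • w) x) ?_ ?_ ?_ ?_ hx
    · intro y hy
      simpa using hk y hy l ((Finset.le_sup (f := k) hy).trans hl)
    · simp
    · intro a b _ _ ha hb
      rw [map_add]
      exact add_nonneg ha hb
    · intro a y _ hy
      have : a • y = (a : ℝ) • y := rfl
      rw [this, map_smul]
      exact mul_nonneg a.2 hy
  · exact add_mem hm.2 (nsmul_mem hw.2 l)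

variable (N) in
/-- For `τ ⊆ σ`, the inclusion `R[σ^∨ ∩ M] → R[τ^∨ ∩ M]` of monoid algebras. -/
def coordMap (R : Type u) [CommRing R] {τ σ : PointedCone ℝ V} (h : τ ≤ σ) :
    AddMonoidAlgebra R (dualMonoid N σ) →ₐ[R] AddMonoidAlgebra R (dualMonoid N τ) :=
  AddMonoidAlgebra.mapDomainAlgHom R R (AddSubmonoid.inclusion (dualMonoid_anti N h))

theorem coordMap_single (R : Type u) [CommRing R] {τ σ : PointedCone ℝ V} (h : τ ≤ σ)
    (m : dualMonoid N σ) (r : R) :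
    coordMap N R h (AddMonoidAlgebra.single m r) =
      AddMonoidAlgebra.single (AddSubmonoid.inclusion (dualMonoid_anti N h) m) r :=
  AddMonoidAlgebra.mapDomain_single

/-- If `τ = σ ∩ ker w` is a face of `σ`, then `R[τ^∨ ∩ M]` is the localization of `R[σ^∨ ∩ M]`
at the monomial with exponent `w`. -/
theorem isLocalization_coordMap (R : Type u) [CommRing R] {τ σ : PointedCone ℝ V} (h : τ ≤ σ)
    (hσ : IsPolycone N σ) {w : Module.Dual ℝ V} (hw : w ∈ dualMonoid N σ)
    (e : (τ : Set V) = (σ : Set V) ∩ {x | w x = 0}) :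
    letI := (coordMap N R h).toRingHom.toAlgebra
    IsLocalization.Away
      (AddMonoidAlgebra.single (⟨w, hw⟩ : dualMonoid N σ) (1 : R))
      (AddMonoidAlgebra R (dualMonoid N τ)) := by
  let _ := (coordMap N R h).toRingHom.toAlgebra
  have alg : ∀ a : AddMonoidAlgebra R (dualMonoid N σ),
      algebraMap _ (AddMonoidAlgebra R (dualMonoid N τ)) a = coordMap N R h a := fun _ => rfl
  have hneg : -w ∈ dualMonoid N τ := by
    refine mem_dualMonoid.2 ⟨fun x hx => ?_, neg_mem hw.2⟩
    have : x ∈ (τ : Set V) := hx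
    rw [e] at this
    have h0 : w x = 0 := this.2
    simp [h0]
  have hpow : ∀ k : ℕ, (AddMonoidAlgebra.single (⟨w, hw⟩ : dualMonoid N σ) (1 : R)) ^ k =
      AddMonoidAlgebra.single (k • (⟨w, hw⟩ : dualMonoid N σ)) (1 : R) := by
    intro k
    simp [AddMonoidAlgebra.single_pow]
  refine IsLocalization.Away.mk _ ?_ ?_ ?_
  · rw [alg, coordMap_single]
    refine IsUnit.of_mul_eq_one (AddMonoidAlgebra.single ⟨-w, hneg⟩ 1) ?_
    rw [AddMonoidAlgebra.single_mul_single, AddMonoidAlgebra.one_def]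
    congr 1
    · ext1
      simp
    · simp
  · suffices H : ∀ s : AddMonoidAlgebra R (dualMonoid N τ), ∃ k : ℕ, ∀ l : ℕ, k ≤ l →
        ∃ a, s * (coordMap N R h (AddMonoidAlgebra.single ⟨w, hw⟩ 1)) ^ l = coordMap N R h a by
      intro s
      obtain ⟨k, hk⟩ := H s
      exact ⟨k, hk k le_rfl⟩
    intro s
    induction s using AddMonoidAlgebra.induction_linear with
    | zero => exact ⟨0, fun l _ => ⟨0, by simp⟩⟩
    | add x y hx hy =>
      obtain ⟨k, hk⟩ := hx
      obtain ⟨k', hk'⟩ := hy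
      refine ⟨max k k', fun l hl => ?_⟩
      obtain ⟨a, ha⟩ := hk l ((le_max_left _ _).trans hl)
      obtain ⟨b, hb⟩ := hk' l ((le_max_right _ _).trans hl)
      exact ⟨a + b, by rw [add_mul, ha, hb, map_add]⟩
    | single m r =>
      obtain ⟨k, hk⟩ := exists_add_nsmul_mem hσ hw e m.2
      refine ⟨k, fun l hl => ⟨AddMonoidAlgebra.single ⟨_, hk l hl⟩ r, ?_⟩⟩
      rw [← map_pow, hpow, coordMap_single, coordMap_single, AddMonoidAlgebra.single_mul_single]
      congr 1
      simp
  · intro a b hab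
    refine ⟨0, ?_⟩
    have : a = b := AddMonoidAlgebra.mapDomain_injective
      (AddSubmonoid.inclusion_injective (dualMonoid_anti N h)) hab
    rw [this]

theorem isOpenImmersion_coordMap (R : Type u) [CommRing R] {τ σ : PointedCone ℝ V} (h : τ ≤ σ)
    (hσ : IsPolycone N σ) (hf : IsFace N τ σ) :
    IsOpenImmersion (Spec.map (CommRingCat.ofHom (coordMap N R h).toRingHom)) := by
  obtain ⟨w, hw, e⟩ := hf
  let _ := (coordMap N R h).toRingHom.toAlgebra
  have := isLocalization_coordMap R h hσ hw e
  exact IsOpenImmersion.of_isLocalization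
    (AddMonoidAlgebra.single (⟨w, hw⟩ : dualMonoid N σ) (1 : R))

theorem range_coordMap (R : Type u) [CommRing R] {τ σ : PointedCone ℝ V} (h : τ ≤ σ)
    (hσ : IsPolycone N σ) {w : Module.Dual ℝ V} (hw : w ∈ dualMonoid N σ)
    (e : (τ : Set V) = (σ : Set V) ∩ {x | w x = 0}) :
    Set.range (PrimeSpectrum.comap (coordMap N R h).toRingHom) =
      {p | AddMonoidAlgebra.single (⟨w, hw⟩ : dualMonoid N σ) (1 : R) ∉ p.asIdeal} := by
  let _ := (coordMap N R h).toRingHom.toAlgebra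
  have := isLocalization_coordMap R h hσ hw e
  exact PrimeSpectrum.localization_away_comap_range (AddMonoidAlgebra R (dualMonoid N τ))
    (AddMonoidAlgebra.single (⟨w, hw⟩ : dualMonoid N σ) (1 : R))

end Localization

namespace Fan

variable {V : Type u} [AddCommGroup V] [Module ℝ V] {N : AddSubgroup V} (F : Fan N)

/-- The fan is complete: the union of its cones is `V`. -/
def IsComplete : Prop := ⋃ σ ∈ F.cones, (σ : Set V) = Set.univ

/-- Inside a fan, the order by inclusion and the order "is a face of" are the same. -/
theorem le_iff_isFace (τ σ : F.cones) : τ ≤ σ ↔ IsFace N τ.1 σ.1 := by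
  refine ⟨fun h => ?_, fun h => h.le⟩
  have := (F.isFace_inter τ.1 τ.2 σ.1 σ.2).2
  rwa [inf_eq_left.2 (show τ.1 ≤ σ.1 from h)] at this

/-- The inductive system `σ ↦ X_σ(R) = Spec R[σ^∨ ∩ M]` over the fan, ordered by
"is a face of". -/
def diagram (R : Type u) [CommRing R] : F.cones ⥤ Scheme.{u} where
  obj σ := Spec (.of (AddMonoidAlgebra R (dualMonoid N σ.1)))
  map {τ σ} f := Spec.map (CommRingCat.ofHom
    (coordMap N R (show τ.1 ≤ σ.1 from leOfHom f)).toRingHom)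
  map_id σ := by
    rw [← Spec.map_id]
    congr 1
    ext1
    exact congrArg AlgHom.toRingHom (AddMonoidAlgebra.mapDomainAlgHom_id (R := R) (A := R))
  map_comp {ρ τ σ} f g := by
    rw [← Spec.map_comp]
    congr 1
    ext1
    exact congrArg AlgHom.toRingHom (AddMonoidAlgebra.mapDomainAlgHom_comp (R := R) (A := R)
      (AddSubmonoid.inclusion (dualMonoid_anti N (show τ.1 ≤ σ.1 from leOfHom g)))
      (AddSubmonoid.inclusion (dualMonoid_anti N (show ρ.1 ≤ τ.1 from leOfHom f))))

/-- The structure morphism `X_σ(R) → Spec R`. -/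
def chartToSpec (R : Type u) [CommRing R] (σ : F.cones) :
    (F.diagram R).obj σ ⟶ Spec (.of R) :=
  Spec.map (CommRingCat.ofHom (algebraMap R (AddMonoidAlgebra R (dualMonoid N σ.1))))

/-- The structure morphisms of the `X_σ(R)` form a cocone. -/
def coconeToSpec (R : Type u) [CommRing R] : Cocone (F.diagram R) where
  pt := Spec (.of R)
  ι :=
    { app := F.chartToSpec R
      naturality := by
        intro τ σ f
        dsimp [diagram, chartToSpec]
        rw [Category.comp_id, ← Spec.map_comp]
        congr 1
        ext1
        exact (coordMap N R (show τ.1 ≤ σ.1 from leOfHom f)).comp_algebraMap }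

instance isOpenImmersion_map (R : Type u) [CommRing R] {τ σ : F.cones} (f : τ ⟶ σ) :
    IsOpenImmersion ((F.diagram R).map f) :=
  isOpenImmersion_coordMap R _ (F.isPolycone σ.1 σ.2) ((F.le_iff_isFace τ σ).1 (leOfHom f))

instance isLocallyDirected (R : Type u) [CommRing R] :
    (F.diagram R ⋙ Scheme.forget).IsLocallyDirected where
  cond := by
    intro τ₁ τ₂ σ f₁ f₂ x₁ x₂ hx
    have l₁ : τ₁.1 ≤ σ.1 := leOfHom f₁
    have l₂ : τ₂.1 ≤ σ.1 := leOfHom f₂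
    have hσ := F.isPolycone σ.1 σ.2
    obtain ⟨w₁, hw₁, e₁⟩ := (F.le_iff_isFace τ₁ σ).1 (leOfHom f₁)
    obtain ⟨w₂, hw₂, e₂⟩ := (F.le_iff_isFace τ₂ σ).1 (leOfHom f₂)
    have r₁ := range_coordMap R l₁ hσ hw₁ e₁
    have r₂ := range_coordMap R l₂ hσ hw₂ e₂
    have hw := add_mem hw₁ hw₂
    have e : ((τ₁.1 ⊓ τ₂.1 : PointedCone ℝ V) : Set V) = (σ.1 : Set V) ∩ {x | (w₁ + w₂) x = 0} := by
      rw [Submodule.coe_inf, e₁, e₂]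
      ext x
      simp only [Set.mem_inter_iff, Set.mem_ofPred_eq, LinearMap.add_apply, SetLike.mem_coe]
      constructor
      · rintro ⟨⟨hx, h⟩, -, h'⟩
        exact ⟨hx, by rw [h, h', add_zero]⟩
      · rintro ⟨hx, h⟩
        have h1 : 0 ≤ w₁ x := hw₁.1 hx
        have h2 : 0 ≤ w₂ x := hw₂.1 hx
        exact ⟨⟨hx, by linarith⟩, hx, by linarith⟩
    let ρ : F.cones := ⟨τ₁.1 ⊓ τ₂.1,
      F.face_mem τ₁.1 τ₁.2 _ (F.isFace_inter τ₁.1 τ₁.2 τ₂.1 τ₂.2).1⟩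
    have l : ρ.1 ≤ σ.1 := inf_le_left.trans l₁
    have r := range_coordMap R l hσ hw e
    let g₁ : ρ ⟶ τ₁ := homOfLE (inf_le_left : τ₁.1 ⊓ τ₂.1 ≤ τ₁.1)
    let g₂ : ρ ⟶ τ₂ := homOfLE (inf_le_right : τ₁.1 ⊓ τ₂.1 ≤ τ₂.1)
    have hx' : (F.diagram R).map f₁ x₁ = (F.diagram R).map f₂ x₂ := hx
    have m₁ : (F.diagram R).map f₁ x₁ ∈ Set.range (PrimeSpectrum.comap (coordMap N R l₁).toRingHom) :=
      ⟨x₁, rfl⟩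
    have m₂ : (F.diagram R).map f₁ x₁ ∈ Set.range (PrimeSpectrum.comap (coordMap N R l₂).toRingHom) :=
      ⟨x₂, hx'.symm⟩
    have m : (F.diagram R).map f₁ x₁ ∈ Set.range (PrimeSpectrum.comap (coordMap N R l).toRingHom) := by
      rw [r₁] at m₁
      rw [r₂] at m₂
      rw [r]
      intro h
      have hmul : AddMonoidAlgebra.single (⟨w₁ + w₂, hw⟩ : dualMonoid N σ.1) (1 : R) =
          AddMonoidAlgebra.single (⟨w₁, hw₁⟩ : dualMonoid N σ.1) (1 : R) *
          AddMonoidAlgebra.single (⟨w₂, hw₂⟩ : dualMonoid N σ.1) (1 : R) := by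
        rw [AddMonoidAlgebra.single_mul_single, one_mul]
        rfl
      rw [hmul] at h
      rcases (PrimeSpectrum.isPrime _).mem_or_mem h with h | h
      · exact m₁ h
      · exact m₂ h
    obtain ⟨z, hz⟩ := m
    refine ⟨ρ, g₁, g₂, z, ?_, ?_⟩
    · apply ((F.diagram R).map f₁).isOpenEmbedding.injective
      rw [← hz]
      change ((F.diagram R).map g₁ ≫ (F.diagram R).map f₁) z = _
      rw [← Functor.map_comp]
      rfl
    · apply ((F.diagram R).map f₂).isOpenEmbedding.injective
      rw [← hx', ← hz]
      change ((F.diagram R).map g₂ ≫ (F.diagram R).map f₂) z = _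
      rw [← Functor.map_comp]
      rfl

instance finite_cones : Finite F.cones := F.finite

/-- The toric scheme `X_Σ(R)` over `R`: the inductive limit of the `X_σ(R)`, i.e. their glueing. -/
def toricScheme (R : Type u) [CommRing R] : Scheme.{u} := colimit (F.diagram R)

/-- The structure morphism `X_Σ(R) → Spec R`, which restricts to `X_σ(R) → Spec R` for
every cone `σ` of the fan. -/
def structureMorphism (R : Type u) [CommRing R] : F.toricScheme R ⟶ Spec (.of R) :=
  colimit.desc (F.diagram R) (F.coconeToSpec R)

end Fan

end Toric

end

/-! Properness is tested by the valuative criterion; a point of a chart with values in a field `K`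
amounts to ring data on `R` together with a multiplicative map from `σ^∨ ∩ M` to `K`.

Completeness gives existence of lifts. Take a `K`-point and the smallest cone `σ` whose chart
contains it; monomials that do not vanish there have exponents in `σ^⊥`. If no chart of a cone `τ ⊇
σ` receives the lift, each such `τ` has an exponent `m_τ` whose value is not integral, so the
inverse value lies in the maximal ideal. The star of `σ` is complete modulo the span of `σ`, which
forces a nontrivial relation `∑ n_τ m_τ = 0` with `n_τ ≥ 0` (`IsComplete.exists_relation`). Then a
nonempty product of elements of the maximal ideal equals 1, which is absurd.

Uniqueness holds for every fan: by `exists_separating`, the coordinate ring of `σ ∩ τ` is generated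
by those of `σ` and `τ`. Finite type is Gordan's lemma.

Conversely, for `x ∈ V` the point sending the monomial of exponent `m` to `t^(m x)` in a field of
Hahn series extends over the valuation ring into some chart `σ`. Hence `m x ≥ 0` for all `m ∈ σ^∨ ∩
M`, and `x ∈ σ` by duality. The convex geometry all rests on `farkas`. -/

namespace Toric

/-! ### Farkas' lemma over the integers -/

/-- An integral form of Bartl's algebraic version of the Farkas lemma. -/
theorem farkas {W E ι : Type*} [AddCommGroup W] [AddCommGroup E] [LinearOrder E]
    [IsOrderedAddMonoid E] (s : Finset ι) (a : ι → W →+ ℤ) (b : W →+ E)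
    (h : ∀ w, (∀ i ∈ s, 0 ≤ a i w) → 0 ≤ b w) :
    ∃ p : ℤ, 0 < p ∧ ∃ c : ι → E, (∀ i, 0 ≤ c i) ∧ ∀ w, p • b w = ∑ i ∈ s, a i w • c i := by
  classical
  induction s using Finset.induction_on generalizing a b with
  | empty =>
    refine ⟨1, one_pos, 0, fun _ => le_rfl, fun w => ?_⟩
    have h₁ := h w (by simp)
    have h₂ := h (-w) (by simp)
    rw [map_neg, Left.nonneg_neg_iff] at h₂
    simp [le_antisymm h₂ h₁]
  | insert j s hj ih =>
    by_cases hs : ∀ w, (∀ i ∈ s, 0 ≤ a i w) → 0 ≤ b w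
    · obtain ⟨p, hp, c, hc, e⟩ := ih a b hs
      refine ⟨p, hp, fun i => if i = j then 0 else c i, fun i => ?_, fun w => ?_⟩
      · dsimp only
        split_ifs
        exacts [le_rfl, hc i]
      · rw [e, Finset.sum_insert hj]
        dsimp only
        rw [if_pos rfl, smul_zero, zero_add]
        refine Finset.sum_congr rfl fun i hi => ?_
        rw [if_neg (ne_of_mem_of_not_mem hi hj)]
    · push Not at hs
      obtain ⟨v, hv, hbv⟩ := hs
      have hjv : a j v < 0 := by
        by_contra! hjv
        exact absurd (h v (by simpa [hjv] using hv)) hbv.not_ge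
      -- Up to the factor `-a j v > 0`, the vector `(-a j v) • w + (a j w) • v` is the projection of
      -- `w` along `v` onto the kernel of `a j`. Pulling all functionals back along it makes the
      -- `j`-th condition automatic; clearing the denominator keeps the coefficients integral.
      have key : ∀ w, (∀ i ∈ s, 0 ≤ ((-a j v) • a i + (a i v) • a j) w) →
          0 ≤ ((-a j v) • b + (zmultiplesHom E (b v)).comp (a j)) w := by
        intro w hw
        have := h ((-a j v) • w + (a j w) • v) (by
          intro i hi
          rcases Finset.mem_insert.1 hi with rfl | hi
          · simp [mul_comm]
          · simpa [mul_comm] using hw i hi)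
        simpa using this
      obtain ⟨p, hp, c, hc, e⟩ := ih _ _ key
      -- The coefficient at `j` collects the multiples of `a j` in the projected identity; it is
      -- nonnegative because `b v < 0` and `a i v ≥ 0` on `s`.
      refine ⟨p * (-a j v), mul_pos hp (neg_pos.2 hjv),
        fun i => if i = j then ∑ i ∈ s, a i v • c i - p • b v else (-a j v) • c i,
        fun i => ?_, fun w => ?_⟩
      · dsimp only
        split_ifs
        · exact sub_nonneg.2 ((smul_nonpos_of_nonneg_of_nonpos hp.le hbv.le).trans
            (Finset.sum_nonneg fun i hi => smul_nonneg (hv i hi) (hc i)))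
        · exact smul_nonneg (neg_pos.2 hjv).le (hc i)
      · have e' := e w
        have : ∑ i ∈ s, a i w • (if i = j then ∑ i ∈ s, a i v • c i - p • b v
            else (-a j v) • c i) = ∑ i ∈ s, a i w • (-a j v) • c i :=
          Finset.sum_congr rfl fun i hi => by rw [if_neg (ne_of_mem_of_not_mem hi hj)]
        rw [Finset.sum_insert hj, this]
        dsimp only
        rw [if_pos rfl]
        simp only [AddMonoidHom.add_apply, AddMonoidHom.smul_apply, AddMonoidHom.comp_apply,
          zmultiplesHom_apply, smul_add, add_smul,
          Finset.sum_add_distrib, smul_eq_mul] at e'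
        rw [smul_sub, Finset.smul_sum, mul_smul, eq_comm, sub_add_eq_add_sub, sub_eq_iff_eq_add]
        rw [smul_comm (a j w) p, e', add_comm]
        congr 1 <;> refine Finset.sum_congr rfl fun i _ => ?_
        · rw [smul_smul, mul_comm]
        · rw [smul_smul, mul_comm]

/-! ### Lattices, duality of polycones and Gordan's alternative -/

section Cones

variable {V : Type u} [AddCommGroup V] [Module ℝ V] {N : AddSubgroup V}

/-- `N` is finitely generated and torsion-free, hence free. A `ℤ`-basis spans `V`, and equality of
the ranks makes it independent over `ℝ` as well. -/
theorem exists_basis [FiniteDimensional ℝ V] (hN : IsZStructure N) :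
    ∃ (ι : Type u) (_ : Fintype ι) (b : Module.Basis ι ℝ V), (∀ i, b i ∈ N) ∧
      ∀ x ∈ N, x ∈ AddSubgroup.closure (Set.range b) := by
  have : Module.Finite ℤ N := by
    have := (AddGroup.fg_iff_addSubgroup_fg N).2 hN.fg
    exact Module.Finite.iff_addGroup_fg.2 this
  have : Module.IsTorsionFree ℤ V := Module.IsTorsionFree.trans_faithfulSMul ℤ ℝ V
  have : Module.IsTorsionFree ℤ N :=
    Subtype.val_injective.moduleIsTorsionFree (Subtype.val : N → V) fun _ _ => rfl
  have : Module.Free ℤ N := Module.free_of_finite_type_torsion_free'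
  let c := Module.Free.chooseBasis ℤ N
  have hc : ∀ x ∈ N, x ∈ AddSubgroup.closure (Set.range fun i => (c i : V)) := by
    intro x hx
    have h := congrArg (Subtype.val : N → V) (c.sum_repr (⟨x, hx⟩ : N))
    rw [← show _ = x from h]
    simp only [AddSubgroup.val_finsetSum, AddSubgroup.coe_zsmul]
    exact sum_mem fun i _ => zsmul_mem
      (AddSubgroup.subset_closure (Set.mem_range_self (f := fun i => (c i : V)) i)) _
  have hspan : ⊤ ≤ Submodule.span ℝ (Set.range fun i => (c i : V)) := by
    rw [← hN.span_eq_top, Submodule.span_le]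
    intro x hx
    have := AddSubgroup.closure_le (Submodule.span ℝ
      (Set.range fun i => (c i : V))).toAddSubgroup |>.2 Submodule.subset_span
    exact this (hc x hx)
  refine ⟨_, inferInstance, basisOfTopLeSpanOfCardEqFinrank (fun i => (c i : V)) hspan ?_, ?_, ?_⟩
  · rw [← hN.rank_eq, Module.finrank_eq_card_chooseBasisIndex]
  · simp
  · simpa using hc

/-- The integral pairing of `M` and `N`. -/
noncomputable def pairing (N : AddSubgroup V) : dualLattice N →+ N →+ ℤ :=
  AddMonoidHom.mk' (fun m => AddMonoidHom.mk' (fun x => (m.2 x x.2).choose) fun x y =>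
    Int.cast_injective (α := ℝ) (by
      rw [Int.cast_add, ← (m.2 _ (x + y).2).choose_spec, ← (m.2 _ x.2).choose_spec,
        ← (m.2 _ y.2).choose_spec]
      simp)) fun m n => by
    ext x
    refine Int.cast_injective (α := ℝ) ?_
    change (((m + n).2 _ x.2).choose : ℝ) =
      (((m.2 _ x.2).choose + (n.2 _ x.2).choose : ℤ) : ℝ)
    rw [Int.cast_add, ← ((m + n).2 _ x.2).choose_spec, ← (m.2 _ x.2).choose_spec,
      ← (n.2 _ x.2).choose_spec]
    simp

theorem pairing_cast (m : dualLattice N) (x : N) : ((pairing N m x : ℤ) : ℝ) = m.1 x.1 :=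
  ((m.2 _ x.2).choose_spec).symm

theorem coord_mem_dualLattice {ι : Type*} (b : Module.Basis ι ℝ V)
    (hb : ∀ x ∈ N, x ∈ AddSubgroup.closure (Set.range b)) (i : ι) :
    b.coord i ∈ dualLattice N := by
  classical
  intro x hx
  have hx' := hb x hx
  clear hx
  induction hx' using AddSubgroup.closure_induction with
  | mem x hx =>
    obtain ⟨j, rfl⟩ := hx
    exact ⟨if j = i then 1 else 0, by simp [Finsupp.single_apply]⟩
  | zero => exact ⟨0, by simp⟩
  | add x y _ _ hx hy =>
    obtain ⟨k, hk⟩ := hx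
    obtain ⟨l, hl⟩ := hy
    exact ⟨k + l, by rw [map_add, hk, hl]; push_cast; rfl⟩
  | neg x _ hx =>
    obtain ⟨k, hk⟩ := hx
    exact ⟨-k, by rw [map_neg, hk]; push_cast; rfl⟩

/-- `M` contains the basis dual to a `ℤ`-basis of `N`, so it separates the points of `V`. -/
theorem eq_zero_of_dualLattice [FiniteDimensional ℝ V] (hN : IsZStructure N) {x : V}
    (h : ∀ m ∈ dualLattice N, m x = 0) : x = 0 := by
  obtain ⟨ι, _, b, -, hb⟩ := exists_basis hN
  exact b.ext_elem fun i => by simpa using h _ (coord_mem_dualLattice b hb i)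

theorem hull_nonneg {s : Set V} {u : Module.Dual ℝ V} (h : ∀ x ∈ s, 0 ≤ u x) :
    ∀ x ∈ PointedCone.hull ℝ s, 0 ≤ u x := by
  intro x hx
  refine Submodule.span_induction (p := fun x _ => 0 ≤ u x) h (by simp) ?_ ?_ hx
  · intro a b _ _ ha hb
    rw [map_add]
    exact add_nonneg ha hb
  · intro a y _ hy
    rw [show a • y = (a : ℝ) • y from rfl, map_smul]
    exact mul_nonneg a.2 hy

theorem smul_mem_cone (σ : PointedCone ℝ V) {a : ℝ} (ha : 0 ≤ a) {x : V} (hx : x ∈ σ) :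
    a • x ∈ σ := Submodule.smul_mem σ (⟨a, ha⟩ : {c : ℝ // 0 ≤ c}) hx

/-- A polycone is cut out by the elements of its dual monoid. -/
theorem IsPolycone.mem_of_nonneg [FiniteDimensional ℝ V] (hN : IsZStructure N)
    {σ : PointedCone ℝ V} (hσ : IsPolycone N σ) {x : V} (h : ∀ m ∈ dualMonoid N σ, 0 ≤ m x) :
    x ∈ σ := by
  obtain ⟨s, hs, rfl⟩ := hσ
  -- The group here is `M`: the generators of the cone act on it integrally, whereas `x` acts with
  -- real values. This is why the target of `b` in `farkas` is a general ordered group.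
  obtain ⟨p, hp, c, hc, e⟩ := farkas s.attach (fun y => (pairing N).flip ⟨y.1, hs y.2⟩)
    ((AddMonoidHom.mk' (fun m : Module.Dual ℝ V => m x) fun _ _ => rfl).comp
      (dualLattice N).subtype) (by
    intro m hm
    refine h m.1 (mem_dualMonoid.2 ⟨hull_nonneg fun y hy => ?_, m.2⟩)
    have := hm ⟨y, hy⟩ (Finset.mem_attach _ _)
    rw [AddMonoidHom.flip_apply] at this
    have h' := pairing_cast m ⟨y, hs hy⟩
    rw [← h']
    exact_mod_cast this)
  have hp' : (0 : ℝ) < p := by exact_mod_cast hp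
  have hx : (p : ℝ) • x - ∑ y ∈ s.attach, c y • y.1 = 0 := by
    refine eq_zero_of_dualLattice hN fun m hm => ?_
    have := e ⟨m, hm⟩
    simp only [AddMonoidHom.comp_apply, AddSubgroup.subtype_apply, AddMonoidHom.mk'_apply,
      AddMonoidHom.flip_apply, zsmul_eq_mul, pairing_cast] at this
    rw [map_sub, map_smul, map_sum, smul_eq_mul, this, sub_eq_zero]
    refine Finset.sum_congr rfl fun y _ => ?_
    rw [map_smul, smul_eq_mul, mul_comm]
  have hx' : x = (p : ℝ)⁻¹ • ∑ y ∈ s.attach, c y • y.1 := by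
    rw [← sub_eq_zero.1 hx, smul_smul, inv_mul_cancel₀ hp'.ne', one_smul]
  rw [hx']
  exact smul_mem_cone _ (inv_nonneg.2 hp'.le) (sum_mem fun y _ =>
    smul_mem_cone _ (hc y) (Submodule.subset_span y.2))

/-- Gordan's alternative for finitely many elements of `M`. -/
theorem exists_neg_or_exists_relation (hN : IsZStructure N) {ι : Type*} [Fintype ι]
    (m : ι → dualLattice N) :
    (∃ x : V, ∀ i, (m i).1 x < 0) ∨ ∃ n : ι → ℕ, n ≠ 0 ∧ ∑ i, n i • (m i).1 = 0 := by
  -- An extra coordinate `t` homogenises the strict inequalities: the question is whether `m i x ≤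
  -- -t` for all `i` forces `t ≤ 0`. If so, evaluating the Farkas identity at `(0, 1)` shows that
  -- the coefficients have sum `p > 0`, and at `(x, 0)` that they form a relation. If not, a
  -- solution with `t > 0` makes all `m i x` negative.
  by_cases h : ∀ w : N × ℤ, (∀ i ∈ (Finset.univ : Finset ι),
      0 ≤ (-((pairing N (m i)).comp (AddMonoidHom.fst N ℤ)) - AddMonoidHom.snd N ℤ) w) →
      0 ≤ (-AddMonoidHom.snd N ℤ) w
  · right
    obtain ⟨p, hp, c, hc, e⟩ := farkas _ _ _ h
    lift c to ι → ℕ using hc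
    refine ⟨c, ?_, ?_⟩
    · rintro rfl
      have := e (0, 1)
      simp at this
      omega
    · refine LinearMap.ext_on hN.span_eq_top fun x hx => ?_
      have := e (⟨x, hx⟩, 0)
      simp only [AddMonoidHom.neg_apply, AddMonoidHom.coe_snd, neg_zero, smul_eq_mul, mul_zero,
        AddMonoidHom.sub_apply, AddMonoidHom.comp_apply, AddMonoidHom.coe_fst, sub_zero,
        neg_mul, Finset.sum_neg_distrib] at this
      have h' : ((∑ i, pairing N (m i) ⟨x, hx⟩ * (c i : ℤ) : ℤ) : ℝ) = 0 := by
        exact_mod_cast (neg_eq_zero.1 this.symm)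
      push_cast at h'
      simp only [pairing_cast] at h'
      rw [LinearMap.zero_apply, ← h', LinearMap.sum_apply]
      refine Finset.sum_congr rfl fun i _ => ?_
      rw [LinearMap.smul_apply, nsmul_eq_mul, mul_comm]
  · left
    push Not at h
    obtain ⟨w, hw, hw'⟩ := h
    refine ⟨w.1, fun i => ?_⟩
    have h₁ := hw i (Finset.mem_univ _)
    simp only [AddMonoidHom.neg_apply, AddMonoidHom.coe_snd,
        AddMonoidHom.sub_apply, AddMonoidHom.comp_apply, AddMonoidHom.coe_fst] at h₁ hw'
    have : pairing N (m i) w.1 < 0 := by omega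
    rw [← pairing_cast]
    exact_mod_cast this

end Cones

/-! ### Separation of cones and stars in complete fans -/

namespace Fan

variable {V : Type u} [AddCommGroup V] [Module ℝ V] {N : AddSubgroup V} (F : Fan N)

/-- The intersection of two cones of a fan. -/
def inter (σ τ : F.cones) : F.cones :=
  ⟨σ.1 ⊓ τ.1, F.face_mem σ.1 σ.2 _ (F.isFace_inter σ.1 σ.2 τ.1 τ.2).1⟩

/-- Two cones of a fan are separated by an element of `M`. -/
theorem exists_separating [FiniteDimensional ℝ V] (hN : IsZStructure N) (σ τ : F.cones) :
    ∃ u ∈ dualMonoid N σ.1, -u ∈ dualMonoid N τ.1 ∧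
      ((F.inter σ τ).1 : Set V) = (σ.1 : Set V) ∩ {x | u x = 0} := by
  classical
  obtain ⟨s, hs, es⟩ := F.isPolycone σ.1 σ.2
  obtain ⟨t, ht, et⟩ := F.isPolycone τ.1 τ.2
  obtain ⟨w, hw, ew⟩ := (F.isFace_inter σ.1 σ.2 τ.1 τ.2).1
  -- It suffices to treat one generator `x` of `σ` at a time and add up. If no suitable `u` exists,
  -- duality for the cone `σ - τ` gives `-x = a - b`; then `b = a + x` lies in the face `σ ∩ τ` of
  -- `σ`, so `x` does too, contradicting `x ∉ τ`.
  have key : ∀ x ∈ s, x ∉ τ.1 → ∃ u ∈ dualMonoid N σ.1, -u ∈ dualMonoid N τ.1 ∧ 0 < u x := by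
    intro x hx hxτ
    have hxσ : x ∈ σ.1 := by rw [es]; exact Submodule.subset_span hx
    have hC : IsPolycone N (PointedCone.hull ℝ ((s ∪ t.image Neg.neg : Finset V) : Set V)) := by
      refine ⟨_, ?_, rfl⟩
      intro y hy
      rcases Finset.mem_union.1 hy with hy | hy
      · exact hs hy
      · obtain ⟨z, hz, rfl⟩ := Finset.mem_image.1 hy
        exact neg_mem (ht hz)
    have hsub : ∀ y ∈ PointedCone.hull ℝ ((s ∪ t.image Neg.neg : Finset V) : Set V),
        ∃ a ∈ σ.1, ∃ b ∈ τ.1, y = a - b := by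
      intro y hy
      induction hy using Submodule.span_induction with
      | mem y hy =>
        rcases Finset.mem_union.1 hy with hy | hy
        · exact ⟨y, by rw [es]; exact Submodule.subset_span hy, 0, zero_mem _, by simp⟩
        · obtain ⟨z, hz, rfl⟩ := Finset.mem_image.1 hy
          exact ⟨0, zero_mem _, z, by rw [et]; exact Submodule.subset_span hz, by simp⟩
      | zero => exact ⟨0, zero_mem _, 0, zero_mem _, by simp⟩
      | add y z _ _ hy hz =>
        obtain ⟨a, ha, b, hb, rfl⟩ := hy
        obtain ⟨a', ha', b', hb', rfl⟩ := hz
        exact ⟨a + a', add_mem ha ha', b + b', add_mem hb hb', by abel⟩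
      | smul r y _ hy =>
        obtain ⟨a, ha, b, hb, rfl⟩ := hy
        exact ⟨r • a, Submodule.smul_mem _ _ ha, r • b, Submodule.smul_mem _ _ hb, smul_sub _ _ _⟩
    have hx' : -x ∉ PointedCone.hull ℝ ((s ∪ t.image Neg.neg : Finset V) : Set V) := by
      intro h
      obtain ⟨a, ha, b, hb, e⟩ := hsub _ h
      have hb' : b = a + x := by rw [← neg_neg x, e]; abel
      have hbσ : b ∈ ((σ.1 ⊓ τ.1 : PointedCone ℝ V) : Set V) := ⟨by
        rw [hb']; exact add_mem ha hxσ, hb⟩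
      rw [ew] at hbσ
      have h0 : w b = 0 := hbσ.2
      have h1 : 0 ≤ w a := hw.1 ha
      have h2 : 0 ≤ w x := hw.1 hxσ
      rw [hb', map_add] at h0
      have : x ∈ ((σ.1 ⊓ τ.1 : PointedCone ℝ V) : Set V) := by
        rw [ew]
        exact ⟨hxσ, show w x = 0 by linarith⟩
      exact hxτ this.2
    by_contra! hu
    refine hx' (hC.mem_of_nonneg hN fun u hu' => ?_)
    rw [map_neg]
    rw [mem_dualMonoid] at hu'
    refine neg_nonneg.2 (hu u ?_ ?_)
    · refine mem_dualMonoid.2 ⟨fun y hy => hu'.1 y ?_, hu'.2⟩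
      rw [es] at hy
      exact Submodule.span_mono (by simp) hy
    · refine mem_dualMonoid.2 ⟨fun y hy => ?_, neg_mem hu'.2⟩
      rw [et] at hy
      refine hull_nonneg (fun z hz => ?_) y hy
      have := hu'.1 (-z) (Submodule.subset_span (by
        rw [Finset.mem_coe]
        exact Finset.mem_union_right _ (Finset.mem_image_of_mem _ hz)))
      simpa using this
  choose! v hv hv' hv'' using key
  have hu : ∑ x ∈ s with x ∉ τ.1, v x ∈ dualMonoid N σ.1 :=
    sum_mem fun x hx => hv x (Finset.mem_filter.1 hx).1 (Finset.mem_filter.1 hx).2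
  have hu' : -∑ x ∈ s with x ∉ τ.1, v x ∈ dualMonoid N τ.1 := by
    rw [← Finset.sum_neg_distrib]
    exact sum_mem fun x hx => hv' x (Finset.mem_filter.1 hx).1 (Finset.mem_filter.1 hx).2
  have hpos : ∀ x ∈ s, x ∉ τ.1 → 0 < (∑ x ∈ s with x ∉ τ.1, v x) x := by
    intro x hx hxτ
    have hxσ : x ∈ σ.1 := by rw [es]; exact Submodule.subset_span hx
    rw [LinearMap.sum_apply]
    refine (hv'' x hx hxτ).trans_le (Finset.single_le_sum (f := fun y => v y x) (fun y hy => ?_)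
      (Finset.mem_filter.2 ⟨hx, hxτ⟩))
    exact (hv y (Finset.mem_filter.1 hy).1 (Finset.mem_filter.1 hy).2).1 hxσ
  generalize ∑ x ∈ s with x ∉ τ.1, v x = u at hu hu' hpos
  refine ⟨u, hu, hu', ?_⟩
  ext x
  constructor
  · rintro ⟨hx, hx'⟩
    have h1 : 0 ≤ u x := hu.1 hx
    have h2 : 0 ≤ (-u) x := hu'.1 hx'
    rw [LinearMap.neg_apply] at h2
    exact ⟨hx, show u x = 0 by linarith⟩
  · rintro ⟨hx, hx'⟩
    refine ⟨hx, ?_⟩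
    have hx₂ := hx
    rw [es, SetLike.mem_coe] at hx₂
    suffices H : 0 ≤ u x ∧ (u x = 0 → x ∈ τ.1) from H.2 hx'
    clear hx' hx
    induction hx₂ using Submodule.span_induction with
    | mem x hx =>
      refine ⟨hu.1 (show x ∈ σ.1 by rw [es]; exact Submodule.subset_span hx), fun h => ?_⟩
      by_contra hxτ
      exact (hpos x hx hxτ).ne' h
    | zero => exact ⟨by simp, fun _ => zero_mem _⟩
    | add x y _ _ hx hy =>
      rw [map_add]
      exact ⟨add_nonneg hx.1 hy.1, fun h =>
        add_mem (hx.2 (by linarith [hx.1, hy.1])) (hy.2 (by linarith [hx.1, hy.1]))⟩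
    | smul r x _ hx =>
      rw [show r • x = (r : ℝ) • x from rfl, map_smul, smul_eq_mul]
      refine ⟨mul_nonneg r.2 hx.1, fun h => ?_⟩
      rcases mul_eq_zero.1 h with h | h
      · rw [h, zero_smul]
        exact zero_mem _
      · exact Submodule.smul_mem _ r (hx.2 h)

/-- In a complete fan the star of a cone `σ` is complete modulo the span of `σ`, in dual form:
elements of the dual monoids of the cones containing `σ` that vanish on `σ` are dependent with
nonnegative coefficients. -/
theorem IsComplete.exists_relation [FiniteDimensional ℝ V] (hN : IsZStructure N)
    (hF : F.IsComplete) (σ : F.cones) {ι : Type*} [Fintype ι] (c : ι → F.cones)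
    (hc : ∀ τ : F.cones, σ ≤ τ → ∃ i, c i = τ)
    (m : ι → Module.Dual ℝ V) (hm : ∀ i, m i ∈ dualMonoid N (c i).1)
    (hmσ : ∀ i, ∀ x ∈ σ.1, m i x = 0) :
    ∃ n : ι → ℕ, n ≠ 0 ∧ ∑ i, n i • m i = 0 := by
  refine (exists_neg_or_exists_relation hN fun i => ⟨m i, (hm i).2⟩).resolve_left ?_
  rintro ⟨x, hx⟩
  obtain ⟨s, hs, es⟩ := F.isPolycone σ.1 σ.2
  have hsσ : ∀ z ∈ s, z ∈ σ.1 := fun z hz => by rw [es]; exact Submodule.subset_span hz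
  -- The sum of the generators is a relative interior point of `σ`: a face of `σ` containing `y` is
  -- all of `σ`.
  set y : V := ∑ z ∈ s, z with hy
  have hyσ : y ∈ σ.1 := sum_mem hsσ
  have hcov : ∀ n : ℕ, ∃ τ : F.cones, y + (1 / ((n : ℝ) + 1)) • x ∈ τ.1 := by
    intro n
    have : y + (1 / ((n : ℝ) + 1)) • x ∈ ⋃ σ ∈ F.cones, (σ : Set V) := by
      rw [show _ = _ from hF]; trivial
    simp only [Set.mem_iUnion] at this
    obtain ⟨τ, hτ, h⟩ := this
    exact ⟨⟨τ, hτ⟩, h⟩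
  choose f hf using hcov
  -- A single cone `τ` contains `y + x / (n + 1)` for infinitely many `n`. Passing to the limit in
  -- the inequalities cutting out `τ` gives `y ∈ τ`, whence `σ ≤ τ`. The element `m i` belonging to
  -- `τ` vanishes at `y` and is negative at `x`, so it is negative at these points of `τ`.
  obtain ⟨τ, hτ⟩ := Finite.exists_infinite_fiber f
  have hτ' := Set.infinite_coe_iff.1 hτ
  have hyτ : y ∈ τ.1 := by
    refine (F.isPolycone τ.1 τ.2).mem_of_nonneg hN fun u hu => ?_
    by_contra! hneg
    obtain ⟨k, hk⟩ := exists_nat_gt (u x / -(u y))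
    obtain ⟨n, hn, hkn⟩ := hτ'.exists_gt k
    have h1 : 0 ≤ u (y + (1 / ((n : ℝ) + 1)) • x) := by
      refine hu.1 ?_
      have := hf n
      rwa [show f n = τ from hn] at this
    rw [map_add, map_smul, smul_eq_mul] at h1
    have hn0 : (0 : ℝ) < n + 1 := by positivity
    have h2 : u x / -(u y) < n + 1 := by
      have : (k : ℝ) < n := by exact_mod_cast hkn
      linarith
    rw [div_lt_iff₀ (by linarith)] at h2
    have h3 : 0 ≤ ((n : ℝ) + 1) * (u y + 1 / ((n : ℝ) + 1) * u x) := mul_nonneg hn0.le h1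
    have h4 : ((n : ℝ) + 1) * (u y + 1 / ((n : ℝ) + 1) * u x) = (n + 1) * u y + u x := by
      field_simp
    linarith
  have hle : σ ≤ τ := by
    obtain ⟨w, hw, ew⟩ := (F.isFace_inter σ.1 σ.2 τ.1 τ.2).1
    have hyw : y ∈ (σ.1 : Set V) ∩ {x | w x = 0} := by rw [← ew]; exact ⟨hyσ, hyτ⟩
    have hwy : ∑ z ∈ s, w z = 0 := by rw [← map_sum]; exact hyw.2
    have hw0 := (Finset.sum_eq_zero_iff_of_nonneg fun z hz => hw.1 (hsσ z hz)).1 hwy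
    change σ.1 ≤ τ.1
    conv_lhs => rw [es]
    refine Submodule.span_le.2 fun z hz => ?_
    have : z ∈ ((σ.1 ⊓ τ.1 : PointedCone ℝ V) : Set V) := by
      rw [ew]; exact ⟨hsσ z hz, hw0 z hz⟩
    exact this.2
  obtain ⟨i, rfl⟩ := hc τ hle
  obtain ⟨n, hn⟩ := hτ'.nonempty
  have h1 : 0 ≤ m i (y + (1 / ((n : ℝ) + 1)) • x) := by
    refine (hm i).1 ?_
    have := hf n
    rwa [show f n = c i from hn] at this
  rw [map_add, map_smul, hmσ i y hyσ, zero_add, smul_eq_mul] at h1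
  exact absurd (nonneg_of_mul_nonneg_right h1 (by positivity)) (hx i).not_ge

end Fan

/-! ### Finite generation of the dual monoids -/

/-- **Gordan's lemma** for the monoids `σ^∨ ∩ M`. -/
theorem fg_dualMonoid {V : Type u} [AddCommGroup V] [Module ℝ V] {N : AddSubgroup V}
    [FiniteDimensional ℝ V] (hN : IsZStructure N)
    {σ : PointedCone ℝ V} (hσ : IsPolycone N σ) : AddMonoid.FG (dualMonoid N σ) := by
  obtain ⟨ι, _, b, hbN, hb⟩ := exists_basis hN
  obtain ⟨s, hs, rfl⟩ := hσ
  -- Coordinates of `u` in the dual basis are written as differences of natural numbers, and the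
  -- values of `u` on the generators of `σ` become natural slack variables. Membership in `σ^∨ ∩ M`
  -- is then the linear equation `f t = g t` over `ℕ`, whose solution monoid is finitely generated,
  -- and `q` recovers `u`.
  let f : ((ι ⊕ ι) ⊕ s → ℕ) →+ (s → ℝ) := AddMonoidHom.mk'
    (fun t z => ∑ i, (t (.inl (.inl i)) : ℝ) * b.coord i z) fun t t' => by
      ext z
      simp [add_mul, Finset.sum_add_distrib]
  let g : ((ι ⊕ ι) ⊕ s → ℕ) →+ (s → ℝ) := AddMonoidHom.mk'
    (fun t z => ∑ i, (t (.inl (.inr i)) : ℝ) * b.coord i z + t (.inr z)) fun t t' => by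
      ext z
      simp only [Pi.add_apply, Nat.cast_add, add_mul, Finset.sum_add_distrib]
      ring
  let q : ((ι ⊕ ι) ⊕ s → ℕ) →+ Module.Dual ℝ V := AddMonoidHom.mk'
    (fun t => ∑ i, ((t (.inl (.inl i)) : ℝ) - t (.inl (.inr i))) • b.coord i) fun t t' => by
      rw [← Finset.sum_add_distrib]
      refine Finset.sum_congr rfl fun i _ => ?_
      rw [← add_smul]
      congr 1
      simp only [Pi.add_apply, Nat.cast_add]
      ring
  have hq : ∀ t (z : s), q t z = f t z - (g t z - t (.inr z)) := by
    intro t z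
    simp only [q, f, g, AddMonoidHom.mk'_apply, LinearMap.sum_apply, LinearMap.smul_apply,
      smul_eq_mul, sub_mul, Finset.sum_sub_distrib, add_sub_cancel_right]
  suffices h : dualMonoid N (PointedCone.hull ℝ (s : Set V)) = (f.eqLocusM g).map q by
    rw [AddMonoid.fg_iff_addSubmonoid_fg]
    rw [h]
    exact (AddSubmonoid.fg_eqLocusM f g).map q
  ext u
  constructor
  · intro hu
    have hz : ∀ z : s, ∃ n : ℕ, u z = n := by
      intro z
      obtain ⟨k, hk⟩ := hu.2 z (hs z.2)
      have h0 : 0 ≤ u z := hu.1 (Submodule.subset_span z.2)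
      lift k to ℕ using by rw [hk] at h0; exact_mod_cast h0
      exact ⟨k, by simpa using hk⟩
    choose r hr using hz
    choose k hk using fun i => hu.2 (b i) (hbN i)
    have hqu : q (Sum.elim (Sum.elim (fun i => (k i).toNat) fun i => (-k i).toNat) r) = u := by
      refine b.ext fun j => ?_
      classical
      have : (((k j).toNat - (-k j).toNat : ℤ) : ℝ) = k j := by
        rw [Int.toNat_sub_toNat_neg]
      push_cast at this
      simp [q, LinearMap.sum_apply, Finsupp.single_apply, hk, this]
    refine ⟨_, ?_, hqu⟩
    ext z
    have h1 := hq (Sum.elim (Sum.elim (fun i => (k i).toNat) fun i => (-k i).toNat) r) z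
    rw [hqu, Sum.elim_inr, hr z] at h1
    linarith
  · rintro ⟨t, ht, rfl⟩
    refine mem_dualMonoid.2 ⟨hull_nonneg fun z hz => ?_, ?_⟩
    · have ht' : f t ⟨z, hz⟩ = g t ⟨z, hz⟩ := congrFun ht _
      rw [show q t z = _ from hq t ⟨z, hz⟩, ht']
      simp
    · refine sum_mem fun i _ => ?_
      have := zsmul_mem (coord_mem_dualLattice b hb i)
        ((t (.inl (.inl i)) : ℤ) - t (.inl (.inr i)))
      convert this using 1
      rw [← Int.cast_smul_eq_zsmul ℝ]
      push_cast
      rfl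

end Toric

/-! ### Charts of the toric scheme and points with values in local rings -/

namespace Toric

section Rings

/-- A ring homomorphism into `K` with values in the image of an injective `A → K` lifts to `A`. -/
theorem exists_lift_of_mem_range {P A K : Type*} [CommRing P] [CommRing A] [CommRing K]
    (j : A →+* K) (hj : Function.Injective j) (f : P →+* K) (hf : ∀ x, f x ∈ j.range) :
    ∃ g : P →+* A, j.comp g = f := by
  let e : A ≃+* j.range := RingEquiv.ofBijective j.rangeRestrict
    ⟨fun a b h => hj (congrArg Subtype.val h), j.rangeRestrict_surjective⟩
  refine ⟨(e.symm : j.range →+* A).comp (f.codRestrict j.range hf), ?_⟩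
  ext x
  exact congrArg Subtype.val (e.apply_symm_apply ⟨f x, hf x⟩)

theorem map_mem_of_single_mem {R S G : Type*} [CommRing R] [CommRing S] [AddCommMonoid G]
    (f : AddMonoidAlgebra R G →+* S) (B : Subring S)
    (h₀ : ∀ r, f (algebraMap R _ r) ∈ B) (h₁ : ∀ m, f (AddMonoidAlgebra.single m 1) ∈ B)
    (x : AddMonoidAlgebra R G) : f x ∈ B := by
  induction x using AddMonoidAlgebra.induction_linear with
  | zero => simp
  | add x y hx hy => rw [map_add]; exact add_mem hx hy
  | single m r =>
    have : AddMonoidAlgebra.single m r =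
        algebraMap R (AddMonoidAlgebra R G) r * AddMonoidAlgebra.single m 1 := by
      simp [AddMonoidAlgebra.single_mul_single]
    rw [this, map_mul]
    exact mul_mem (h₀ r) (h₁ m)

end Rings

namespace Fan

variable {V : Type u} [AddCommGroup V] [Module ℝ V] {N : AddSubgroup V} (F : Fan N)
variable (R : Type u) [CommRing R]

/-- The coordinate ring of a chart. -/
abbrev Coord (σ : F.cones) : Type u := AddMonoidAlgebra R (dualMonoid N σ.1)

/-- The ring homomorphism between the coordinate rings of charts of comparable cones. -/
noncomputable def restrict {τ σ : F.cones} (h : τ ≤ σ) : F.Coord R σ →+* F.Coord R τ :=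
  (coordMap N R (show τ.1 ≤ σ.1 from h)).toRingHom

/-- The open immersion of a chart into the toric scheme. -/
noncomputable def chart (σ : F.cones) : Spec (.of (F.Coord R σ)) ⟶ F.toricScheme R :=
  colimit.ι (F.diagram R) σ

instance (σ : F.cones) : IsOpenImmersion (F.chart R σ) :=
  inferInstanceAs (IsOpenImmersion (colimit.ι (F.diagram R) σ))

theorem chart_structureMorphism (σ : F.cones) :
    F.chart R σ ≫ F.structureMorphism R =
      Spec.map (CommRingCat.ofHom (algebraMap R (F.Coord R σ))) :=
  colimit.ι_desc (F.coconeToSpec R) σ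

theorem restrict_chart {τ σ : F.cones} (h : τ ≤ σ) :
    Spec.map (CommRingCat.ofHom (F.restrict R h)) ≫ F.chart R σ = F.chart R τ :=
  colimit.w (F.diagram R) (homOfLE h)

theorem exists_mem_chart (x : F.toricScheme R) : ∃ σ, x ∈ Set.range (F.chart R σ) :=
  Scheme.IsLocallyDirected.ι_jointly_surjective (F.diagram R) x

theorem inter_le_left (σ τ : F.cones) : F.inter σ τ ≤ σ :=
  show σ.1 ⊓ τ.1 ≤ σ.1 from inf_le_left

theorem inter_le_right (σ τ : F.cones) : F.inter σ τ ≤ τ :=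
  show σ.1 ⊓ τ.1 ≤ τ.1 from inf_le_right

theorem le_inter {ρ σ τ : F.cones} (h : ρ ≤ σ) (h' : ρ ≤ τ) : ρ ≤ F.inter σ τ :=
  show ρ.1 ≤ σ.1 ⊓ τ.1 from le_inf h h'

theorem range_chart_mono {τ σ : F.cones} (h : τ ≤ σ) :
    Set.range (F.chart R τ) ⊆ Set.range (F.chart R σ) := by
  rintro _ ⟨x, rfl⟩
  rw [← F.restrict_chart R h]
  exact ⟨_, rfl⟩

/-- Points of two charts are identified in the colimit only through a chart of some common smaller
cone, and every such cone lies in `σ ∩ τ`. -/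
theorem range_chart_inter (σ τ : F.cones) :
    Set.range (F.chart R σ) ∩ Set.range (F.chart R τ) ⊆ Set.range (F.chart R (F.inter σ τ)) := by
  rintro _ ⟨⟨x, rfl⟩, ⟨y, hy⟩⟩
  obtain ⟨ρ, f, g, z, rfl, -⟩ :=
    (Scheme.IsLocallyDirected.ι_eq_ι_iff (F.diagram R)).1 hy.symm
  refine F.range_chart_mono R (F.le_inter (leOfHom f) (leOfHom g)) ⟨z, ?_⟩
  rw [← F.restrict_chart R (leOfHom f)]
  rfl

/-- The chart of a face is the locus of the chart where a monomial does not vanish. -/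
theorem mem_range_chart_of_face {τ σ : F.cones} {w : Module.Dual ℝ V} (hw : w ∈ dualMonoid N σ.1)
    (e : (τ.1 : Set V) = (σ.1 : Set V) ∩ {x | w x = 0}) {B : Type u} [CommRing B] [IsLocalRing B]
    (f : F.Coord R σ →+* B)
    (hf : IsUnit (f (AddMonoidAlgebra.single ⟨w, hw⟩ 1))) :
    (Spec.map (CommRingCat.ofHom f) ≫ F.chart R σ) (IsLocalRing.closedPoint B) ∈
      Set.range (F.chart R τ) := by
  have hle : τ ≤ σ := by
    intro x hx
    have : x ∈ (τ.1 : Set V) := hx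
    rw [e] at this
    exact this.1
  have h : PrimeSpectrum.comap f (IsLocalRing.closedPoint B) ∈
      Set.range (PrimeSpectrum.comap (F.restrict R hle)) := by
    have := range_coordMap R (show τ.1 ≤ σ.1 from hle) (F.isPolycone σ.1 σ.2) hw e
    rw [restrict, this]
    intro h
    exact (IsLocalRing.mem_maximalIdeal _).1 h hf
  obtain ⟨z, hz⟩ := h
  refine ⟨z, ?_⟩
  rw [← F.restrict_chart R hle]
  exact congrArg (F.chart R σ) hz

/-- A morphism from the spectrum of a local ring that sends the closed point into a chart is given
by a ring homomorphism from the coordinate ring of the chart. -/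
theorem exists_factor {B : Type u} [CommRing B] [IsLocalRing B] (g : Spec (.of B) ⟶ F.toricScheme R)
    (σ : F.cones) (h : g (IsLocalRing.closedPoint B) ∈ Set.range (F.chart R σ)) :
    ∃ ψ : F.Coord R σ →+* B, Spec.map (CommRingCat.ofHom ψ) ≫ F.chart R σ = g := by
  have hr : Set.range g ⊆ Set.range (F.chart R σ) := by
    have := Scheme.preimage_eq_top_of_closedPoint_mem (f := g) (U := (F.chart R σ).opensRange) h
    rintro _ ⟨x, rfl⟩
    have hx : x ∈ g ⁻¹ᵁ (F.chart R σ).opensRange := by rw [this]; trivial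
    exact hx
  obtain ⟨φ, hφ⟩ := Spec.map_surjective (IsOpenImmersion.lift (F.chart R σ) g hr)
  refine ⟨φ.hom, ?_⟩
  rw [CommRingCat.ofHom_hom, hφ, IsOpenImmersion.lift_fac]

variable {R}

theorem chart_injective {B : Type u} [CommRing B] {σ : F.cones} {f g : F.Coord R σ →+* B}
    (h : Spec.map (CommRingCat.ofHom f) ≫ F.chart R σ =
      Spec.map (CommRingCat.ofHom g) ≫ F.chart R σ) : f = g := by
  rw [cancel_mono] at h
  exact congrArg CommRingCat.Hom.hom (Spec.map_injective h)

theorem spec_restrict_chart {B : Type u} [CommRing B] {τ σ : F.cones} (h : τ ≤ σ)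
    (f : F.Coord R τ →+* B) :
    Spec.map (CommRingCat.ofHom (f.comp (F.restrict R h))) ≫ F.chart R σ =
      Spec.map (CommRingCat.ofHom f) ≫ F.chart R τ := by
  rw [← F.restrict_chart R h, CommRingCat.ofHom_comp, Spec.map_comp, Category.assoc]

theorem spec_chart_structureMorphism {B : Type u} [CommRing B] {σ : F.cones}
    (f : F.Coord R σ →+* B) :
    (Spec.map (CommRingCat.ofHom f) ≫ F.chart R σ) ≫ F.structureMorphism R =
      Spec.map (CommRingCat.ofHom (f.comp (algebraMap R _))) := by
  rw [Category.assoc, chart_structureMorphism, ← Spec.map_comp, ← CommRingCat.ofHom_comp]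

/-- The spectrum of a field has one point, so lying in both charts means lying in the chart of the
intersection. The two factorisations agree since charts are monomorphisms. -/
theorem exists_common_factor {K : Type u} [Field K] {σ τ : F.cones} (f : F.Coord R σ →+* K)
    (g : F.Coord R τ →+* K)
    (h : Spec.map (CommRingCat.ofHom f) ≫ F.chart R σ =
      Spec.map (CommRingCat.ofHom g) ≫ F.chart R τ) :
    ∃ ψ : F.Coord R (F.inter σ τ) →+* K,
      ψ.comp (F.restrict R (F.inter_le_left σ τ)) = f ∧
      ψ.comp (F.restrict R (F.inter_le_right σ τ)) = g := by
  obtain ⟨ψ, hψ⟩ := F.exists_factor R (Spec.map (CommRingCat.ofHom f) ≫ F.chart R σ)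
    (F.inter σ τ) (F.range_chart_inter R σ τ ⟨⟨_, rfl⟩, by rw [h]; exact ⟨_, rfl⟩⟩)
  refine ⟨ψ, F.chart_injective ?_, F.chart_injective ?_⟩
  · rw [← hψ, spec_restrict_chart]
  · rw [← h, ← hψ, spec_restrict_chart]

theorem restrict_single {τ σ : F.cones} (h : τ ≤ σ) {m : Module.Dual ℝ V}
    (hm : m ∈ dualMonoid N σ.1) (r : R) :
    F.restrict R h (AddMonoidAlgebra.single ⟨m, hm⟩ r) =
      AddMonoidAlgebra.single ⟨m, dualMonoid_anti N h hm⟩ r :=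
  coordMap_single R _ _ r

theorem restrict_comp_algebraMap {τ σ : F.cones} (h : τ ≤ σ) :
    (F.restrict R h).comp (algebraMap R _) = algebraMap R _ :=
  (coordMap N R (show τ.1 ≤ σ.1 from h)).comp_algebraMap

/-! ### Quasi-compactness, quasi-separatedness and finite type -/

variable (R)

instance compactSpace_toricScheme : CompactSpace (F.toricScheme R) := by
  have : Finite (Scheme.IsLocallyDirected.openCover (F.diagram R)).I₀ :=
    inferInstanceAs (Finite F.cones)
  have : ∀ i, CompactSpace ((Scheme.IsLocallyDirected.openCover (F.diagram R)).X i) := fun i =>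
    inferInstanceAs (CompactSpace (Spec (.of (F.Coord R i))))
  exact (Scheme.IsLocallyDirected.openCover (F.diagram R)).compactSpace

/-- Over each affine chart `τ` the fibre product with the chart of `σ` is the image of the affine
chart of `σ ∩ τ`, hence compact. This is the input for quasi-separatedness of the whole scheme. -/
instance quasiCompact_chart (σ : F.cones) : QuasiCompact (F.chart R σ) := by
  have : ∀ i, IsAffine ((Scheme.IsLocallyDirected.openCover (F.diagram R)).X i) := fun i =>
    inferInstanceAs (IsAffine (Spec (.of (F.Coord R i))))
  suffices h : ∀ τ, CompactSpace ↥(pullback (F.chart R σ) (F.chart R τ)) from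
    @HasAffineProperty.of_openCover @QuasiCompact.{u} _
      instHasAffinePropertyQuasiCompactCompactSpaceCarrierCarrierCommRingCat.{u} _ _ _
      (Scheme.IsLocallyDirected.openCover (F.diagram R)) this h
  intro τ
  let f := Spec.map (CommRingCat.ofHom (F.restrict R (F.inter_le_left σ τ)))
  let g := Spec.map (CommRingCat.ofHom (F.restrict R (F.inter_le_right σ τ)))
  let q := pullback.lift f g (by rw [restrict_chart, restrict_chart])
  have hq : Function.Surjective q := by
    intro x
    have hx : F.chart R σ (pullback.fst (F.chart R σ) (F.chart R τ) x) =
        F.chart R τ (pullback.snd (F.chart R σ) (F.chart R τ) x) := by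
      rw [← Scheme.Hom.comp_apply, pullback.condition, Scheme.Hom.comp_apply]
    obtain ⟨z, hz⟩ := F.range_chart_inter R σ τ ⟨⟨_, rfl⟩, ⟨_, hx.symm⟩⟩
    refine ⟨z, ?_⟩
    apply (pullback.fst (F.chart R σ) (F.chart R τ)).isOpenEmbedding.injective
    apply (F.chart R σ).isOpenEmbedding.injective
    have e : q ≫ pullback.fst _ _ ≫ F.chart R σ = F.chart R (F.inter σ τ) := by
      rw [← Category.assoc, pullback.lift_fst, restrict_chart]
    rw [← hz, ← e]
    simp only [Scheme.Hom.comp_apply]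
  exact hq.compactSpace q.continuous

instance quasiSeparatedSpace_toricScheme : QuasiSeparatedSpace (F.toricScheme R) := by
  refine QuasiSeparatedSpace.of_isOpenCover (U := fun σ => (F.chart R σ).opensRange) ?_ ?_ ?_
  · refine TopologicalSpace.IsOpenCover.mk (eq_top_iff.2 fun x _ => ?_)
    obtain ⟨σ, h⟩ := F.exists_mem_chart R x
    exact TopologicalSpace.Opens.mem_iSup.2 ⟨σ, h⟩
  · intro σ U hU hU'
    have := ((F.chart R σ).isCompact_preimage (U := ⟨U, hU'⟩) hU).image (F.chart R σ).continuous
    rwa [Scheme.Hom.coe_preimage, Set.image_preimage_eq_inter_range, Set.inter_comm] at this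
  · intro σ
    have := (isQuasiSeparated_univ (α := Spec (.of (F.Coord R σ)))).image_of_isEmbedding
      (F.chart R σ).isOpenEmbedding.isEmbedding
    rwa [Set.image_univ] at this

theorem locallyOfFiniteType [FiniteDimensional ℝ V] (hN : IsZStructure N) :
    LocallyOfFiniteType (F.structureMorphism R) := by
  have := HasRingHomProperty.instIsZariskiLocalAtSource (P := @LocallyOfFiniteType.{u})
    (Q := RingHom.FiniteType)
  suffices h : ∀ σ, LocallyOfFiniteType (F.chart R σ ≫ F.structureMorphism R) from
    IsZariskiLocalAtSource.of_openCover (P := @LocallyOfFiniteType.{u})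
      (Scheme.IsLocallyDirected.openCover (F.diagram R)) h
  intro σ
  rw [chart_structureMorphism, HasRingHomProperty.Spec_iff (P := @LocallyOfFiniteType.{u})]
  have := fg_dualMonoid hN (F.isPolycone σ.1 σ.2)
  exact RingHom.finiteType_algebraMap.2 (AddMonoidAlgebra.finiteType_of_fg R _)

end Fan
end Toric

/-! ### The valuative criterion and properness for complete fans -/

namespace Toric

namespace Fan

variable {V : Type u} [AddCommGroup V] [Module ℝ V] {N : AddSubgroup V} (F : Fan N)
variable (R : Type u) [CommRing R]

/-- The face `σ ∩ ker u` of a cone of a fan. -/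
def face (σ : F.cones) {u : Module.Dual ℝ V} (hu : u ∈ dualMonoid N σ.1) : F.cones :=
  ⟨σ.1 ⊓ (LinearMap.ker u).restrictScalars _, F.face_mem σ.1 σ.2 _ ⟨u, hu, rfl⟩⟩

/-- A point with values in a field lies in a chart in which only the monomials with exponents in
`σ^⊥` do not vanish. -/
theorem exists_minimal_factor {K : Type u} [Field K] (g : Spec (.of K) ⟶ F.toricScheme R) :
    ∃ (σ : F.cones) (ψ : F.Coord R σ →+* K), Spec.map (CommRingCat.ofHom ψ) ≫ F.chart R σ = g ∧
      ∀ m : dualMonoid N σ.1, ψ (AddMonoidAlgebra.single m 1) ≠ 0 → ∀ x ∈ σ.1, m.1 x = 0 := by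
  obtain ⟨σ₀, h₀⟩ := F.exists_mem_chart R (g (IsLocalRing.closedPoint K))
  -- With `σ` minimal, a monomial of exponent `m` not vanishing at the point would put it in the
  -- chart of the face `σ ∩ ker m`; minimality then gives `σ ⊆ ker m`.
  obtain ⟨σ, hσ⟩ := (Set.toFinite {σ : F.cones |
    g (IsLocalRing.closedPoint K) ∈ Set.range (F.chart R σ)}).exists_minimal ⟨σ₀, h₀⟩
  obtain ⟨ψ, rfl⟩ := F.exists_factor R g σ hσ.1
  refine ⟨σ, ψ, rfl, fun m hm x hx => ?_⟩
  have h := F.mem_range_chart_of_face R (τ := F.face σ m.2) m.2 rfl ψ hm.isUnit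
  have hle : F.face σ m.2 ≤ σ := show (F.face σ m.2).1 ≤ σ.1 from inf_le_left
  exact (hσ.2 h hle hx).2

theorem existence [FiniteDimensional ℝ V] (hN : IsZStructure N) (hF : F.IsComplete) :
    ValuativeCriterion.Existence (F.structureMorphism R) := by
  intro S
  obtain ⟨α, hα⟩ := Spec.map_surjective S.i₂
  obtain ⟨σ, ψ, hψ, hm⟩ := F.exists_minimal_factor R S.i₁
  let j := algebraMap S.R S.K
  have hj : Function.Injective j := IsFractionRing.injective S.R S.K
  have hψα : ψ.comp (algebraMap R _) = j.comp α.hom := by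
    have := S.commSq.w
    rw [← hψ, spec_chart_structureMorphism, ← hα, ← Spec.map_comp] at this
    exact congrArg CommRingCat.Hom.hom (Spec.map_injective this)
  -- This asks for a chart on whose monomials the given point takes integral values. Otherwise each
  -- `τ ≥ σ` supplies an exponent with non-integral, hence nonzero, value, and so vanishing on `σ`:
  -- exactly what `IsComplete.exists_relation` requires.
  have key : ∃ (τ : F.cones) (h : σ ≤ τ), ∀ m : dualMonoid N τ.1,
      ψ (AddMonoidAlgebra.single ⟨m.1, dualMonoid_anti N h m.2⟩ 1) ∈ j.range := by
    by_contra! H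
    choose m hmj using H
    let ι := {τ : F.cones // σ ≤ τ}
    have : Fintype ι := Fintype.ofFinite ι
    let c : ι → dualMonoid N σ.1 := fun i => ⟨(m i.1 i.2).1, dualMonoid_anti N i.2 (m i.1 i.2).2⟩
    let φ : Multiplicative (dualMonoid N σ.1) →* S.K :=
      (ψ : F.Coord R σ →* S.K).comp (AddMonoidAlgebra.of R (dualMonoid N σ.1))
    have hφ : ∀ i, φ (Multiplicative.ofAdd (c i)) ∉ j.range := fun i => hmj i.1 i.2
    have hφ0 : ∀ i, φ (Multiplicative.ofAdd (c i)) ≠ 0 := fun i h =>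
      hφ i (by rw [h]; exact zero_mem _)
    obtain ⟨n, hn0, hn⟩ := hF.exists_relation F hN σ (fun i : ι => i.1) (fun τ h => ⟨⟨τ, h⟩, rfl⟩)
      (fun i => (c i).1) (fun i => (m i.1 i.2).2) fun i => hm (c i) (hφ0 i)
    have hprod : ∏ i, φ (Multiplicative.ofAdd (c i)) ^ n i = 1 := by
      have : ∑ i, n i • c i = 0 := by
        ext1
        simpa using hn
      rw [← map_one φ, ← ofAdd_zero, ← this, ofAdd_sum, map_prod]
      simp only [ofAdd_nsmul, map_pow]
    have hinv : ∀ i, ∃ a : S.R, a ∈ IsLocalRing.maximalIdeal S.R ∧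
        j a = (φ (Multiplicative.ofAdd (c i)))⁻¹ := by
      intro i
      obtain ⟨a, ha⟩ := (ValuationRing.isInteger_or_isInteger S.R
        (φ (Multiplicative.ofAdd (c i)))).resolve_left (hφ i)
      refine ⟨a, fun hu => hφ i ?_, ha⟩
      obtain ⟨b, hb⟩ := hu.exists_right_inv
      refine ⟨b, ?_⟩
      have := congrArg j hb
      rw [map_mul, map_one, show j a = _ from ha] at this
      rw [eq_comm, ← mul_one (φ _), ← this, mul_inv_cancel_left₀ (hφ0 i)]
    choose a ha ha' using hinv
    have ha1 : ∏ i, a i ^ n i = 1 := by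
      apply hj
      rw [map_prod, map_one, ← inv_one, ← hprod, ← Finset.prod_inv_distrib]
      refine Finset.prod_congr rfl fun i _ => ?_
      rw [map_pow, ha', inv_pow]
    obtain ⟨i, hi⟩ := Function.ne_iff.1 hn0
    -- Some exponent `n i` is positive, so the product of the inverse values, which equals 1, would
    -- lie in the maximal ideal.
    refine (IsLocalRing.maximalIdeal.isMaximal S.R).ne_top ((Ideal.eq_top_iff_one _).2 ?_)
    rw [← ha1]
    exact Ideal.mem_of_dvd _ (Finset.dvd_prod_of_mem _ (Finset.mem_univ i))
      (Ideal.pow_mem_of_mem _ (ha i) _ (Nat.pos_of_ne_zero hi))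
  obtain ⟨τ, h, hτ⟩ := key
  obtain ⟨χ, hχ⟩ := exists_lift_of_mem_range j hj (ψ.comp (F.restrict R h))
    (map_mem_of_single_mem _ _ (fun r => by
      have := RingHom.congr_fun hψα r
      rw [RingHom.comp_apply, ← RingHom.comp_apply (F.restrict R h), restrict_comp_algebraMap]
      exact ⟨_, this.symm⟩) fun m => by
      rw [RingHom.comp_apply, show m = ⟨m.1, m.2⟩ from rfl, restrict_single]
      exact hτ m)
  refine ⟨⟨⟨Spec.map (CommRingCat.ofHom χ) ≫ F.chart R τ, ?_, ?_⟩⟩⟩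
  · rw [← Category.assoc, ← Spec.map_comp, ← CommRingCat.ofHom_comp, hχ, spec_restrict_chart, hψ]
  · rw [spec_chart_structureMorphism, ← hα]
    congr 1
    ext1
    ext r
    apply hj
    have := RingHom.congr_fun hψα r
    change (j.comp χ) (algebraMap R _ r) = j (α.hom r)
    rw [hχ, RingHom.comp_apply, ← RingHom.comp_apply (F.restrict R h), restrict_comp_algebraMap]
    exact this

/-- Two lifts land in charts `σ` and `τ` and agree generically in the chart of `σ ∩ τ`. The
coordinate ring of `σ ∩ τ` is generated by the images of the other two, on which the values are
already integral, so both lifts come from one morphism into this smaller chart. -/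
theorem uniqueness [FiniteDimensional ℝ V] (hN : IsZStructure N) :
    ValuativeCriterion.Uniqueness (F.structureMorphism R) := by
  intro S
  refine ⟨fun l₁ l₂ => ?_⟩
  ext1
  let j := algebraMap S.R S.K
  have hj : Function.Injective j := IsFractionRing.injective S.R S.K
  obtain ⟨σ, hσ⟩ := F.exists_mem_chart R (l₁.l (IsLocalRing.closedPoint S.R))
  obtain ⟨τ, hτ⟩ := F.exists_mem_chart R (l₂.l (IsLocalRing.closedPoint S.R))
  obtain ⟨f, hf⟩ := F.exists_factor R _ σ hσ
  obtain ⟨g, hg⟩ := F.exists_factor R _ τ hτ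
  have hf' := l₁.fac_left
  have hg' := l₂.fac_left
  rw [← hf, ← Category.assoc, ← Spec.map_comp, ← CommRingCat.ofHom_comp] at hf'
  rw [← hg, ← Category.assoc, ← Spec.map_comp, ← CommRingCat.ofHom_comp] at hg'
  obtain ⟨ψ, hψf, hψg⟩ := F.exists_common_factor _ _ (hf'.trans hg'.symm)
  obtain ⟨w, hw, hw', e⟩ := F.exists_separating hN σ τ
  obtain ⟨χ, hχ⟩ := exists_lift_of_mem_range j hj ψ
    (map_mem_of_single_mem _ _ (fun r => by
      rw [← F.restrict_comp_algebraMap (F.inter_le_left σ τ), ← RingHom.comp_apply,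
        ← RingHom.comp_assoc, hψf]
      exact ⟨_, rfl⟩) fun m => by
      -- The decomposition is `m = (m + k • w) + k • (-w)`, with the first summand in `σ^∨` and the
      -- second in `τ^∨`.
      obtain ⟨k, hk⟩ := exists_add_nsmul_mem (F.isPolycone σ.1 σ.2) hw e m.2
      have h₁ := hk k le_rfl
      have h₂ := nsmul_mem hw' k
      have hm : AddMonoidAlgebra.single m (1 : R) =
          F.restrict R (F.inter_le_left σ τ) (AddMonoidAlgebra.single ⟨_, h₁⟩ 1) *
          F.restrict R (F.inter_le_right σ τ) (AddMonoidAlgebra.single ⟨_, h₂⟩ 1) := by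
        rw [restrict_single, restrict_single, AddMonoidAlgebra.single_mul_single, one_mul]
        congr 1
        ext1
        simp
      rw [hm, map_mul, ← RingHom.comp_apply, ← RingHom.comp_apply, hψf, hψg]
      exact mul_mem ⟨_, rfl⟩ ⟨_, rfl⟩)
  have hχf : χ.comp (F.restrict R (F.inter_le_left σ τ)) = f :=
    (RingHom.cancel_left hj).1 (by rw [← RingHom.comp_assoc, hχ, hψf])
  have hχg : χ.comp (F.restrict R (F.inter_le_right σ τ)) = g :=
    (RingHom.cancel_left hj).1 (by rw [← RingHom.comp_assoc, hχ, hψg])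
  rw [← hf, ← hg, ← hχf, ← hχg, spec_restrict_chart, spec_restrict_chart]

theorem isProper_of_isComplete [FiniteDimensional ℝ V] (hN : IsZStructure N)
    (hF : F.IsComplete) : IsProper (F.structureMorphism R) := by
  have := F.locallyOfFiniteType R hN
  exact IsProper.of_valuativeCriterion _
    (ValuativeCriterion.iff.2 ⟨F.existence R hN hF, F.uniqueness R hN⟩)

end Fan

/-! ### Completeness from the existence of lifts -/

/-- The valuation ring of Hahn series without terms of negative degree. -/
noncomputable def hahnIntegers (k : Type*) [Field k] : ValuationSubring (HahnSeries ℝ k) where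
  carrier := {x | 0 ≤ x.orderTop}
  mul_mem' {x y} hx hy := by
    rw [Set.mem_ofPred_eq, HahnSeries.orderTop_mul]
    exact add_nonneg hx hy
  one_mem' := by simp
  add_mem' {x y} hx hy := by
    rw [Set.mem_ofPred_eq] at *
    exact (le_min hx hy).trans HahnSeries.min_orderTop_le_orderTop_add
  zero_mem' := by simp
  neg_mem' {x} hx := by simpa using hx
  mem_or_inv_mem' x := by
    change 0 ≤ x.orderTop ∨ 0 ≤ x⁻¹.orderTop
    rcases eq_or_ne x 0 with rfl | hx
    · simp
    by_contra! h
    have e : x.orderTop + x⁻¹.orderTop = 0 := by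
      rw [← HahnSeries.orderTop_mul, mul_inv_cancel₀ hx, HahnSeries.orderTop_one]
    exact ((add_le_of_nonpos_right h.2.le).trans_lt h.1).ne e

theorem mem_hahnIntegers {k : Type*} [Field k] {x : HahnSeries ℝ k} :
    x ∈ hahnIntegers k ↔ 0 ≤ x.orderTop := by
  rw [← SetLike.mem_coe]
  rfl

namespace Fan

variable {V : Type u} [AddCommGroup V] [Module ℝ V] {N : AddSubgroup V} (F : Fan N)
variable (R : Type u) [CommRing R]

theorem isComplete_of_existence [FiniteDimensional ℝ V] (hN : IsZStructure N)
    (hF : F.cones.Nonempty) [Nontrivial R]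
    (h : ValuativeCriterion.Existence (F.structureMorphism R)) : F.IsComplete := by
  obtain ⟨I, hI⟩ := Ideal.exists_maximal R
  let _ := Ideal.Quotient.field I
  obtain ⟨σ₀, hσ₀⟩ := hF
  let τ : F.cones := ⟨σ₀, hσ₀⟩
  refine Set.eq_univ_of_forall fun x => ?_
  -- Real exponents allow `x` to be any vector of `V`, not only a lattice vector.
  let K := HahnSeries ℝ (R ⧸ I)
  let A := hahnIntegers (R ⧸ I)
  let α₀ : R →+* K := HahnSeries.C.comp (Ideal.Quotient.mk I)
  let α : R →+* A := α₀.codRestrict A.toSubring fun r => by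
    refine mem_hahnIntegers.2 ?_
    by_cases hr : Ideal.Quotient.mk I r = 0
    · simp [α₀, hr]
    · change 0 ≤ (HahnSeries.single 0 (Ideal.Quotient.mk I r)).orderTop
      rw [HahnSeries.orderTop_single hr]
      exact le_rfl
  let φ : Multiplicative (dualMonoid N τ.1) →* K :=
    { toFun m := HahnSeries.single (m.toAdd.1 x) 1
      map_one' := by simp
      map_mul' a b := by
        rw [HahnSeries.single_mul_single, one_mul]
        rfl }
  let f : F.Coord R τ →+* K := AddMonoidAlgebra.liftNCRingHom α₀ φ fun _ _ => Commute.all _ _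
  have hf : ∀ m r, f (AddMonoidAlgebra.single m r) = α₀ r * HahnSeries.single (m.1 x) 1 :=
    fun m r => AddMonoidAlgebra.liftNC_single _ _ _ _
  let S : ValuativeCommSq (F.structureMorphism R) :=
    { R := A
      K := K
      i₁ := Spec.map (CommRingCat.ofHom f) ≫ F.chart R τ
      i₂ := Spec.map (CommRingCat.ofHom α)
      commSq := ⟨by
        rw [spec_chart_structureMorphism, ← Spec.map_comp, ← CommRingCat.ofHom_comp]
        congr 2
        ext1 r
        change f (AddMonoidAlgebra.single 0 r) = α₀ r
        rw [hf]
        simp⟩ }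
  obtain ⟨⟨l⟩⟩ := h S
  obtain ⟨σ, hσ⟩ := F.exists_mem_chart R (l.l (IsLocalRing.closedPoint A))
  obtain ⟨g, hg⟩ := F.exists_factor R (B := A) _ σ hσ
  have hg' := l.fac_left
  rw [← hg, ← Category.assoc, ← Spec.map_comp] at hg'
  obtain ⟨ψ, hψg, hψf⟩ := F.exists_common_factor (K := K) ((algebraMap A K).comp g) f hg'
  refine Set.mem_biUnion σ.2 ((F.isPolycone σ.1 σ.2).mem_of_nonneg hN fun m hm => ?_)
  obtain ⟨w, hw, e⟩ := (F.isFace_inter σ.1 σ.2 τ.1 τ.2).2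
  -- The point is prescribed only on exponents in `τ^∨`, while `m` lies in `σ^∨`. Adding `k • w`
  -- moves `m` into `τ^∨`, and comparing orders on the chart of `σ ∩ τ` shows that the monomial of
  -- exponent `m` has order `m x`, which is nonnegative by integrality.
  obtain ⟨k, hk⟩ := exists_add_nsmul_mem (F.isPolycone τ.1 τ.2) hw e
    (dualMonoid_anti N (F.inter_le_left σ τ) hm)
  have hk' := hk k le_rfl
  have hkw := nsmul_mem hw k
  have hmul : F.restrict R (F.inter_le_left σ τ) (AddMonoidAlgebra.single ⟨m, hm⟩ 1) *
      F.restrict R (F.inter_le_right σ τ) (AddMonoidAlgebra.single ⟨_, hkw⟩ 1) =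
      F.restrict R (F.inter_le_right σ τ) (AddMonoidAlgebra.single ⟨_, hk'⟩ 1) := by
    rw [restrict_single, restrict_single, restrict_single, AddMonoidAlgebra.single_mul_single,
      one_mul]
    rfl
  have hmul' := congrArg ψ hmul
  rw [map_mul, ← RingHom.comp_apply, ← RingHom.comp_apply, ← RingHom.comp_apply, hψf, hψg, hf, hf]
    at hmul'
  have hmem : 0 ≤ ((algebraMap A K).comp g (AddMonoidAlgebra.single ⟨m, hm⟩ 1)).orderTop :=
    mem_hahnIntegers.1 (g (AddMonoidAlgebra.single ⟨m, hm⟩ 1)).2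
  have hord := congrArg HahnSeries.orderTop hmul'
  rw [map_one, one_mul, one_mul, HahnSeries.orderTop_mul, HahnSeries.orderTop_single one_ne_zero,
    HahnSeries.orderTop_single one_ne_zero] at hord
  generalize HahnSeries.orderTop
    ((algebraMap A K).comp g (AddMonoidAlgebra.single ⟨m, hm⟩ 1)) = o at hmem hord
  induction o using WithTop.recTopCoe with
  | top =>
    rw [top_add] at hord
    exact (WithTop.coe_ne_top hord.symm).elim
  | coe o =>
    have hmem' : 0 ≤ o := by exact_mod_cast hmem
    have hord' : o + (k • w) x = (m + k • w) x := by exact_mod_cast hord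
    rw [LinearMap.add_apply] at hord'
    linarith

theorem isProper_of_cones_eq_empty (h : F.cones = ∅) : IsProper (F.structureMorphism R) := by
  have : IsEmpty (F.toricScheme R) := ⟨fun x => by
    obtain ⟨σ, -⟩ := F.exists_mem_chart R x
    exact Set.notMem_empty _ (h ▸ σ.2 : σ.1 ∈ (∅ : Set (PointedCone ℝ V)))⟩
  infer_instance

theorem isProper_of_subsingleton [Subsingleton R] : IsProper (F.structureMorphism R) := by
  have : IsEmpty (Spec (.of R)) := inferInstanceAs (IsEmpty (PrimeSpectrum R))
  infer_instance

end Fan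

end Toric

theorem mainTheorem4 {V : Type u} [AddCommGroup V] [Module ℝ V] [FiniteDimensional ℝ V]
    (N : AddSubgroup V) (hN : Toric.IsZStructure N) (F : Toric.Fan N)
    (R : Type u) [CommRing R] :
    IsProper (F.structureMorphism R) ↔
      F.IsComplete ∨ F.cones = ∅ ∨ Subsingleton R := by
  constructor
  · intro h
    rcases F.cones.eq_empty_or_nonempty with hF | hF
    · exact .inr (.inl hF)
    rcases subsingleton_or_nontrivial R with hR | hR
    · exact .inr (.inr hR)
    rw [IsProper.eq_valuativeCriterion] at h
    exact .inl (F.isComplete_of_existence R hN hF h.1.1.1.existence)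
  · rintro (h | h | h)
    · exact F.isProper_of_isComplete R hN h
    · exact F.isProper_of_cones_eq_empty R h
    · exact F.isProper_of_subsingleton R
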